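/- Let $p_0\ge p_1\ge p_2\ge\cdots\ge 0$ be real numbers with $p_n\to 0$, and let $B=\bigcup_{n\ge 0}[n,n+1]\times[0,p_n]$ be the associated infinite step billiard table. Assume that $B$ has at least one corner of interior angle $3\pi/2$, i.e. that $0<p_{k}<p_{k-1}$ for some $k\ge 1$ (this is automatic if all $p_n$ are positive; it excludes only finite rectangles and the degenerate table with all $p_n = 0$). Let $S$ be the surface obtained from the four copies $\{(X,Y)\in\mathbb R^2 : (|X|,|Y|)\in B\}$ of $B$ by identifying $(X,Y)$ with $(-X,Y)$ when $(|X|,|Y|)$ lies on a vertical side $\{k\}\times[p_k,p_{k-1}]$ with $k\ge1$, $p_k<p_{k-1}$, and $(X,Y)$ with $(X,-Y)$ when $(|X|,|Y|)$ lies on a horizontal side $[n,n+1]\times\{p_n\}$. For $\vartheta\in{]0,\pi/2[}$ the billiard flow in direction $\vartheta$ is the unit-speed straight-line motion on $S$ with velocity $(\cos\vartheta,\sin\vartheta)$. Let $\mathcal V\subset S$ be the set of singular vertices, i.e. the points of $S$ over the corners $V_k=(k,p_k)$, $k\ge1$, $0<p_k<p_{k-1}$, at which the table has interior angle $3\pi/2$.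 Then for every $\vartheta\in{]0,\pi/2[}$ and every non-periodic point $x\in S$, the closure of the forward semi-orbit of $x$ and the closure of the backward semi-orbit of $x$, taken in the one-point compactification $S\cup\{\infty\}$, both intersect $\mathcal V\cup\{\infty\}$. This holds for every complete non-periodic orbit through $x$, whichever way orbits that hit a singular vertex are continued beyond it. -/

import Mathlib

open Set Filter Topology OnePoint

/-- The table `⋃ n, [n, n + 1] × [0, p n]` of the step billiard with heights `p`. -/
def stepTable (p : ℕ → ℝ) : Set (ℝ × ℝ) :=
  ⋃ n : ℕ, Icc (n : ℝ) (n + 1) ×ˢ Icc 0 (p n)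

/-- The four copies of the table obtained by reflecting it in the two coordinate axes, as a
subset of the plane with coordinates `(X, Y)`. -/
def unfoldedTable (p : ℕ → ℝ) : Set (ℝ × ℝ) :=
  {z | (|z.1|, |z.2|) ∈ stepTable p}

/-- `(x, y)` lies on one of the vertical sides `{n + 1} × [p (n + 1), p n]` of the table (a
side is present at `n + 1` only if the height really drops there). The left wall `x = 0` is not
listed: in the unfolded table its copies already coincide. -/
def OnVerticalSide (p : ℕ → ℝ) (x y : ℝ) : Prop :=
  ∃ n : ℕ, p (n + 1) < p n ∧ x = n + 1 ∧ y ∈ Icc (p (n + 1)) (p n)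

/-- `(x, y)` lies on one of the upper horizontal sides `[n, n + 1] × {p n}` of the table. The
bottom `y = 0` is not listed: in the unfolded table its copies already coincide. -/
def OnHorizontalSide (p : ℕ → ℝ) (x y : ℝ) : Prop :=
  ∃ n : ℕ, x ∈ Icc (n : ℝ) (n + 1) ∧ y = p n

/-- The side identifications of the unfolding: `(X, Y) ∼ (-X, Y)` on vertical sides and
`(X, Y) ∼ (X, -Y)` on horizontal sides. At a corner all four copies are identified. -/
def sideSetoid (p : ℕ → ℝ) : Setoid (unfoldedTable p) where
  r z w := |z.1.1| = |w.1.1| ∧ |z.1.2| = |w.1.2| ∧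
    (z.1.1 = w.1.1 ∨ OnVerticalSide p |z.1.1| |z.1.2|) ∧
    (z.1.2 = w.1.2 ∨ OnHorizontalSide p |z.1.1| |z.1.2|)
  iseqv :=
    { refl := fun _ => ⟨rfl, rfl, Or.inl rfl, Or.inl rfl⟩
      symm := by
        rintro z w ⟨h1, h2, h3, h4⟩
        refine ⟨h1.symm, h2.symm, ?_, ?_⟩
        · rw [← h1, ← h2]; exact h3.imp Eq.symm id
        · rw [← h1, ← h2]; exact h4.imp Eq.symm id
      trans := by
        rintro z w u ⟨h1, h2, h3, h4⟩ ⟨k1, k2, k3, k4⟩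
        rw [← h1, ← h2] at k3 k4
        refine ⟨h1.trans k1, h2.trans k2, ?_, ?_⟩
        · rcases h3 with h3 | h3
          · exact k3.imp (fun h => h3.trans h) id
          · exact Or.inr h3
        · rcases h4 with h4 | h4
          · exact k4.imp (fun h => h4.trans h) id
          · exact Or.inr h4 }

/-- The invariant surface of the billiard flow: the unfolded table with its sides identified,
with the quotient topology. As a topological space it is the same for all directions. -/
abbrev StepSurface (p : ℕ → ℝ) : Type :=
  Quotient (sideSetoid p)

/-- The point of the surface with plane coordinates `z`. -/
def surfacePoint (p : ℕ → ℝ) (z : ℝ × ℝ) (hz : z ∈ unfoldedTable p) : StepSurface p :=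
  Quotient.mk (sideSetoid p) ⟨z, hz⟩

/-- The singular vertices: the points of the surface over the corners `(n + 1, p (n + 1))` of
the table at which the interior angle is `3π/2`. -/
def singularVertices (p : ℕ → ℝ) : Set (StepSurface p) :=
  {v | ∃ (z : ℝ × ℝ) (hz : z ∈ unfoldedTable p), v = surfacePoint p z hz ∧
    ∃ n : ℕ, 0 < p (n + 1) ∧ p (n + 1) < p n ∧ |z.1| = n + 1 ∧ |z.2| = p (n + 1)}

/-- `γ` is a complete orbit of the billiard flow in direction `θ`: at every time it leaves, and
arrives, along a straight segment of the unfolded table in direction `(cos θ, sin θ)`, with unit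
speed. The side identifications produce the elastic reflections. Away from the singular vertices
the continuation is unique; an orbit reaching a singular vertex may go on along any outgoing
segment, so that every convention for continuing such orbits is covered. -/
def IsBilliardOrbit (p : ℕ → ℝ) (θ : ℝ) (γ : ℝ → StepSurface p) : Prop :=
  ∀ t : ℝ,
    (∃ z : ℝ × ℝ, ∃ ε > (0 : ℝ), ∀ s ∈ Icc 0 ε,
      ∃ hz : z + s • (Real.cos θ, Real.sin θ) ∈ unfoldedTable p,
        γ (t + s) = surfacePoint p (z + s • (Real.cos θ, Real.sin θ)) hz) ∧
    (∃ z : ℝ × ℝ, ∃ ε > (0 : ℝ), ∀ s ∈ Icc 0 ε,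
      ∃ hz : z - s • (Real.cos θ, Real.sin θ) ∈ unfoldedTable p,
        γ (t - s) = surfacePoint p (z - s • (Real.cos θ, Real.sin θ)) hz)

/-- The orbit `γ`, hence its starting point `γ 0`, is periodic. -/
def IsPeriodicOrbit (p : ℕ → ℝ) (γ : ℝ → StepSurface p) : Prop :=
  ∃ T > (0 : ℝ), ∀ t : ℝ, γ (t + T) = γ t

/-- The closure of a subset of the surface in the one-point compactification. -/
def closureWithInfinity (p : ℕ → ℝ) (A : Set (StepSurface p)) : Set (OnePoint (StepSurface p)) :=
  closure ((fun v : StepSurface p => (v : OnePoint (StepSurface p))) '' A)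

/-- The set of singular vertices together with the point at infinity. -/
def singularVerticesWithInfinity (p : ℕ → ℝ) : Set (OnePoint (StepSurface p)) :=
  (fun v : StepSurface p => (v : OnePoint (StepSurface p))) '' singularVertices p ∪ {∞}

/-! A forward semi-orbit that stays bounded and away from the vertices must be periodic. Both
velocity components are positive, so the orbit meets the lines `X ∈ ℤ` at intervals `1 / a` and is
recorded by a column and an entry height. Crossing a column of height `P` shifts the height by `b /
a` modulo `2P` (`Leaves.traverse`); the orbit then enters the next column or, at a wall, the mirror
column (`Leaves.crossing`).

By pigeonhole two records share a column and differ by some `h` with `|h| < δ`, where `δ` is the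
distance kept from the vertices. If `h = 0`, the orbit is periodic (`isPeriodicOrbit_of_eq`).
Otherwise no vertex can separate the two strands, so they stay parallel (`Crossing.parallel`), and
repeated returns move around the circle of length `2P` of each visited column in steps shorter than
`δ`. Hence no visited column ends at a vertex. But boundedness forces a reflection at a wall, which
must then reach the floor, and the orbit runs back through all mirror columns up to one ending at a
vertex (`eq_zero_of_return`).

Backward semi-orbits become forward ones under rotation of the surface by `π`. -/

/-- The height of the column `[c, c + 1]` of the unfolded table. -/
def colHeight (p : ℕ → ℝ) : ℤ → ℝ
  | .ofNat n => p n
  | .negSucc n => p n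

/-- The point `q` of the surface has plane coordinates `(X, Y)`. -/
def Over (p : ℕ → ℝ) (q : StepSurface p) (X Y : ℝ) : Prop :=
  ∃ hz : (X, Y) ∈ unfoldedTable p, q = surfacePoint p (X, Y) hz

theorem mem_unfoldedTable {p : ℕ → ℝ} {X Y : ℝ} :
    (X, Y) ∈ unfoldedTable p ↔ ∃ n : ℕ, (n : ℝ) ≤ |X| ∧ |X| ≤ n + 1 ∧ |Y| ≤ p n := by
  simp [unfoldedTable, stepTable]

theorem Over.mem {p : ℕ → ℝ} {q : StepSurface p} {X Y : ℝ} (h : Over p q X Y) :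
    (X, Y) ∈ unfoldedTable p := h.1

theorem exists_over (p : ℕ → ℝ) (q : StepSurface p) : ∃ X Y, Over p q X Y := by
  induction q using Quotient.inductionOn with
  | h z => exact ⟨z.1.1, z.1.2, z.2, rfl⟩

theorem Over.eq_iff {p : ℕ → ℝ} {q q' : StepSurface p} {X Y X' Y' : ℝ}
    (h : Over p q X Y) (h' : Over p q' X' Y') :
    q = q' ↔ |X| = |X'| ∧ |Y| = |Y'| ∧ (X = X' ∨ OnVerticalSide p |X| |Y|) ∧
      (Y = Y' ∨ OnHorizontalSide p |X| |Y|) := by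
  obtain ⟨hz, rfl⟩ := h
  obtain ⟨hz', rfl⟩ := h'
  exact Quotient.eq

theorem Over.related {p : ℕ → ℝ} {q : StepSurface p} {X Y X' Y' : ℝ}
    (h : Over p q X Y) (h' : Over p q X' Y') :
    |X| = |X'| ∧ |Y| = |Y'| ∧ (X = X' ∨ OnVerticalSide p |X| |Y|) ∧
      (Y = Y' ∨ OnHorizontalSide p |X| |Y|) :=
  (h.eq_iff h').1 rfl

theorem Over.unique {p : ℕ → ℝ} {q q' : StepSurface p} {X Y : ℝ}
    (h : Over p q X Y) (h' : Over p q' X Y) : q = q' :=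
  (h.eq_iff h').2 ⟨rfl, rfl, Or.inl rfl, Or.inl rfl⟩

theorem mem_singularVertices_iff {p : ℕ → ℝ} {q : StepSurface p} {X Y : ℝ} (h : Over p q X Y) :
    q ∈ singularVertices p ↔
      ∃ n : ℕ, 0 < p (n + 1) ∧ p (n + 1) < p n ∧ |X| = n + 1 ∧ |Y| = p (n + 1) := by
  constructor
  · rintro ⟨⟨X', Y'⟩, hz, rfl, n, h1, h2, h3, h4⟩
    obtain ⟨e1, e2, -⟩ := h.related ⟨hz, rfl⟩
    exact ⟨n, h1, h2, e1.trans h3, e2.trans h4⟩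
  · rintro ⟨n, h1, h2, h3, h4⟩
    exact ⟨(X, Y), h.1, h.2, n, h1, h2, h3, h4⟩

/-! ### Columns and sides of the unfolded table -/

section columns

variable {p : ℕ → ℝ} {c : ℤ} {X Y y : ℝ}

@[simp] theorem colHeight_natCast (p : ℕ → ℝ) (n : ℕ) : colHeight p (n : ℤ) = p n := rfl

@[simp] theorem colHeight_negSucc (p : ℕ → ℝ) (n : ℕ) : colHeight p (Int.negSucc n) = p n := rfl

theorem nat_eq_of_between {m n : ℕ} {x : ℝ} (h1 : (n : ℝ) < x) (h2 : x < n + 1)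
    (h3 : (m : ℝ) ≤ x) (h4 : x ≤ m + 1) : m = n := by
  have a : (m : ℝ) < n + 1 := by linarith
  have b : (n : ℝ) < m + 1 := by linarith
  norm_cast at a b
  omega

/-- Inside the open column `c`, the number `|X|` lies strictly between two consecutive naturals. -/
theorem exists_nat_of_mem_column (h1 : (c : ℝ) < X) (h2 : X < c + 1) :
    ∃ n : ℕ, (n : ℝ) < |X| ∧ |X| < n + 1 ∧ colHeight p c = p n := by
  rcases c with n | n
  · simp only [Int.ofNat_eq_natCast, Int.cast_natCast] at h1 h2
    have : (0 : ℝ) ≤ n := n.cast_nonneg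
    rw [abs_of_pos (by linarith)]
    exact ⟨n, h1, h2, rfl⟩
  · rw [Int.cast_negSucc] at h1 h2
    push_cast at h1 h2
    have : (0 : ℝ) ≤ n := n.cast_nonneg
    rw [abs_of_neg (by linarith)]
    exact ⟨n, by linarith, by linarith, rfl⟩

theorem abs_le_colHeight (h1 : (c : ℝ) < X) (h2 : X < c + 1) (h : (X, Y) ∈ unfoldedTable p) :
    |Y| ≤ colHeight p c := by
  obtain ⟨n, a, b, e⟩ := exists_nat_of_mem_column (p := p) h1 h2
  obtain ⟨m, a', b', hm⟩ := mem_unfoldedTable.1 h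
  obtain rfl := nat_eq_of_between a b a' b'
  rwa [e]

theorem not_onVerticalSide (h1 : (c : ℝ) < X) (h2 : X < c + 1) : ¬ OnVerticalSide p |X| y := by
  rintro ⟨m, -, hm, -⟩
  obtain ⟨n, a, b, -⟩ := exists_nat_of_mem_column (p := p) h1 h2
  rw [hm] at a b
  norm_cast at a b
  omega

theorem OnHorizontalSide.eq_colHeight (h : OnHorizontalSide p |X| y) (h1 : (c : ℝ) < X)
    (h2 : X < c + 1) : y = colHeight p c := by
  obtain ⟨m, ⟨a', b'⟩, hm⟩ := h
  obtain ⟨n, a, b, e⟩ := exists_nat_of_mem_column (p := p) h1 h2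
  obtain rfl := nat_eq_of_between a b a' b'
  rw [hm, e]

theorem OnHorizontalSide.at_nat_succ {n : ℕ} (h : OnHorizontalSide p (n + 1) y) :
    y = p n ∨ y = p (n + 1) := by
  obtain ⟨m, ⟨a, b⟩, rfl⟩ := h
  norm_cast at a b
  obtain rfl | rfl : m = n ∨ m = n + 1 := by omega
  · exact Or.inl rfl
  · exact Or.inr rfl

theorem OnVerticalSide.at_nat_succ {n : ℕ} (h : OnVerticalSide p (n + 1) y) :
    p (n + 1) < p n ∧ p (n + 1) ≤ y ∧ y ≤ p n := by
  obtain ⟨m, h1, h2, h3⟩ := h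
  norm_cast at h2
  obtain rfl : n = m := by omega
  exact ⟨h1, h3⟩

end columns

/-- The infimum of the failures would satisfy `Q` by `hl` and could not be an infimum by `hr`.
Orbits are given by local segments only; this extends statements about them to whole intervals. -/
theorem real_induction {Q : ℝ → Prop} {T : ℝ} (h0 : Q 0)
    (hr : ∀ s, 0 ≤ s → s < T → (∀ r, 0 ≤ r → r ≤ s → Q r) →
      ∃ ε > 0, ∀ r, 0 ≤ r → r ≤ ε → Q (s + r))
    (hl : ∀ s, 0 < s → s ≤ T → (∀ r, 0 ≤ r → r < s → Q r) → Q s) :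
    ∀ s, 0 ≤ s → s ≤ T → Q s := by
  by_contra! hcon
  obtain ⟨s₁, hs₁, hs₁T, hQ⟩ := hcon
  let B : Set ℝ := {s | 0 ≤ s ∧ ¬ Q s}
  have hBne : B.Nonempty := ⟨s₁, hs₁, hQ⟩
  have hBb : BddBelow B := ⟨0, fun s hs => hs.1⟩
  set u := sInf B with hu
  have hu0 : 0 ≤ u := le_csInf hBne fun s hs => hs.1
  have hu1 : u ≤ s₁ := csInf_le hBb ⟨hs₁, hQ⟩
  have hbelow : ∀ r, 0 ≤ r → r < u → Q r := fun r h0 h1 => by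
    by_contra h
    exact absurd (csInf_le hBb ⟨h0, h⟩) (not_le.2 h1)
  have hQu : Q u := by
    rcases hu0.eq_or_lt with h | h
    · rwa [← h]
    · exact hl u h (hu1.trans hs₁T) hbelow
  have hlt : u < s₁ := lt_of_le_of_ne hu1 fun h => hQ (h ▸ hQu)
  obtain ⟨ε, hε, hQε⟩ := hr u hu0 (hlt.trans_le hs₁T) fun r h0 h1 => by
    rcases h1.eq_or_lt with h | h
    · rwa [h]
    · exact hbelow r h0 h
  have : u + ε ≤ u := by
    refine le_csInf hBne fun s hs => ?_
    by_contra! hlt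
    have h1 : u ≤ s := csInf_le hBb hs
    have := hQε (s - u) (by linarith) (by linarith)
    rw [add_sub_cancel] at this
    exact hs.2 this
  linarith

/-- In every interval there is a parameter at which a line of direction `(a, b)`, traversed
backwards, is off all sides of the unfolded table. -/
theorem exists_generic (p : ℕ → ℝ) {a b : ℝ} (ha : 0 < a) (hb : 0 < b) (X Y : ℝ) {ε : ℝ}
    (hε : 0 < ε) : ∃ r, 0 < r ∧ r < ε ∧ (∀ y, ¬ OnVerticalSide p |X - r * a| y) ∧
      ∀ x, ¬ OnHorizontalSide p x |Y - r * b| := by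
  have key : ∀ (Z d : ℝ), 0 < d → ∀ v : ℕ → ℝ, {r : ℝ | ∃ n, |Z - r * d| = v n}.Countable := by
    intro Z d hd v
    refine (Set.countable_iUnion fun n : ℕ =>
      ((Set.countable_singleton ((Z - v n) / d)).union
        (Set.countable_singleton ((Z + v n) / d)))).mono ?_
    rintro r ⟨n, hn⟩
    refine Set.mem_iUnion.2 ⟨n, ?_⟩
    rcases abs_choice (Z - r * d) with h | h
    · left
      rw [Set.mem_singleton_iff, eq_div_iff hd.ne']
      linarith
    · right
      rw [Set.mem_singleton_iff, eq_div_iff hd.ne']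
      linarith
  have hc := (key X a ha fun n => (n : ℝ) + 1).union (key Y b hb p)
  obtain ⟨r, hr, hr0, hr1⟩ := (hc.dense_compl ℝ).exists_between hε
  refine ⟨r, hr0, hr1, ?_, ?_⟩
  · rintro y ⟨n, -, h, -⟩
    exact hr (Or.inl ⟨n, h⟩)
  · rintro x ⟨n, -, h⟩
    exact hr (Or.inr ⟨n, h⟩)

/-! ### Orbit segments and the traversal of a column -/

section orbits

variable {p : ℕ → ℝ} {a b : ℝ} {γ γ' : ℝ → StepSurface p} {t t' X Y X' Y' : ℝ} {c : ℤ}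

/-- At time `t` the curve `γ` leaves along the segment of direction `(a, b)` from `(X, Y)`. -/
def Leaves (p : ℕ → ℝ) (a b : ℝ) (γ : ℝ → StepSurface p) (t X Y : ℝ) : Prop :=
  ∃ ε > (0 : ℝ), ∀ s, 0 ≤ s → s ≤ ε → Over p (γ (t + s)) (X + s * a) (Y + s * b)

/-- At time `t` the curve `γ` arrives along the segment of direction `(a, b)` ending in `(X, Y)`. -/
def Arrives (p : ℕ → ℝ) (a b : ℝ) (γ : ℝ → StepSurface p) (t X Y : ℝ) : Prop :=
  ∃ ε > (0 : ℝ), ∀ s, 0 ≤ s → s ≤ ε → Over p (γ (t - s)) (X - s * a) (Y - s * b)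

/-- A complete orbit of the flow with velocity `(a, b)`. -/
def IsLinearOrbit (p : ℕ → ℝ) (a b : ℝ) (γ : ℝ → StepSurface p) : Prop :=
  ∀ t, (∃ X Y, Leaves p a b γ t X Y) ∧ ∃ X Y, Arrives p a b γ t X Y

theorem IsBilliardOrbit.isLinearOrbit {θ : ℝ} (h : IsBilliardOrbit p θ γ) :
    IsLinearOrbit p (Real.cos θ) (Real.sin θ) γ := by
  intro t
  obtain ⟨⟨z, ε, hε, h1⟩, ⟨w, δ, hδ, h2⟩⟩ := h t
  exact ⟨⟨z.1, z.2, ε, hε, fun s h0 hs => h1 s ⟨h0, hs⟩⟩,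
    ⟨w.1, w.2, δ, hδ, fun s h0 hs => h2 s ⟨h0, hs⟩⟩⟩

theorem Leaves.over (h : Leaves p a b γ t X Y) : Over p (γ t) X Y := by
  obtain ⟨ε, hε, h⟩ := h
  simpa using h 0 le_rfl hε.le

theorem Arrives.over (h : Arrives p a b γ t X Y) : Over p (γ t) X Y := by
  obtain ⟨ε, hε, h⟩ := h
  simpa using h 0 le_rfl hε.le

theorem abs_le_of_forall_small {Y b P η : ℝ} (hη : 0 < η)
    (h : ∀ s, 0 < s → s ≤ η → |Y + s * b| ≤ P) : |Y| ≤ P := by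
  have hlim : Tendsto (fun s : ℝ => |Y + s * b|) (𝓝[>] 0) (𝓝 |Y|) := by
    have : Continuous fun s : ℝ => |Y + s * b| := by fun_prop
    have h0 := this.tendsto 0
    simp only [zero_mul, add_zero] at h0
    exact h0.mono_left nhdsWithin_le_nhds
  refine le_of_tendsto hlim ?_
  filter_upwards [Ioc_mem_nhdsGT hη] with s hs using h s hs.1 hs.2

theorem Leaves.eventually_column (ha : 0 < a) (h : Leaves p a b γ t X Y) (h1 : (c : ℝ) ≤ X)
    (h2 : X < c + 1) : ∃ η > 0, ∀ s, 0 < s → s ≤ η → |Y + s * b| ≤ colHeight p c := by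
  obtain ⟨ε, hε, h⟩ := h
  refine ⟨min ε ((c + 1 - X) / a / 2), lt_min hε (by have := sub_pos.2 h2; positivity),
    fun s h0 hs => ?_⟩
  have hs' : s < (c + 1 - X) / a :=
    (hs.trans (min_le_right _ _)).trans_lt (half_lt_self (div_pos (by linarith) ha))
  rw [lt_div_iff₀ ha] at hs'
  have := mul_pos h0 ha
  exact abs_le_colHeight (by linarith) (by linarith) (h s h0.le (hs.trans (min_le_left _ _))).mem

theorem Leaves.abs_snd_le (ha : 0 < a) (h : Leaves p a b γ t X Y) (h1 : (c : ℝ) ≤ X)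
    (h2 : X < c + 1) : |Y| ≤ colHeight p c := by
  obtain ⟨η, hη, h⟩ := h.eventually_column ha h1 h2
  exact abs_le_of_forall_small hη h

/-- The segment still rises after `t`, so it cannot start on the ceiling. This decides between the
identified points `Y` and `-Y`. -/
theorem Leaves.snd_lt (ha : 0 < a) (hb : 0 < b) (h : Leaves p a b γ t X Y) (h1 : (c : ℝ) ≤ X)
    (h2 : X < c + 1) : Y < colHeight p c := by
  obtain ⟨η, hη, h⟩ := h.eventually_column ha h1 h2
  have := (abs_le.1 (h η hη le_rfl)).2
  have := mul_pos hη hb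
  linarith

theorem Leaves.colHeight_pos (ha : 0 < a) (hb : 0 < b) (h : Leaves p a b γ t X Y)
    (h1 : (c : ℝ) ≤ X) (h2 : X < c + 1) : 0 < colHeight p c := by
  have := h.snd_lt ha hb h1 h2
  have := (abs_le.1 (h.abs_snd_le ha h1 h2)).1
  linarith

/-- Arriving segments of equal (or vertically shifted) position are determined by what precedes. -/
theorem Arrives.eq_of_frequently (ha : 0 < a) (hb : 0 < b) (h : Arrives p a b γ t X Y)
    {R : ℝ → ℝ → Prop} {η : ℝ} (hη : 0 < η)
    (hR : ∀ r, 0 < r → r < η → ∃ X' Y', R X' Y' ∧ Over p (γ (t - r)) (X' - r * a) (Y' - r * b)) :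
    R X Y := by
  obtain ⟨ε, hε, h⟩ := h
  obtain ⟨r, h0, h1, hv, hh⟩ := exists_generic p ha hb X Y (lt_min hε hη)
  obtain ⟨X', Y', hR', ho⟩ := hR r h0 (h1.trans_le (min_le_right _ _))
  obtain ⟨-, -, h3, h4⟩ := (h r h0.le (h1.le.trans (min_le_left _ _))).related ho
  have e1 := h3.resolve_right (hv _)
  have e2 := h4.resolve_right (hh _)
  have e1' : X = X' := by linarith
  have e2' : Y = Y' := by linarith
  rwa [e1', e2']

/-- Crossing a column: up to multiples of twice its height, the orbit is a straight line. -/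
theorem Leaves.traverse (hγ : IsLinearOrbit p a b γ) (ha : 0 < a) (hb : 0 < b)
    (h : Leaves p a b γ t X Y) (h1 : (c : ℝ) ≤ X) (h2 : X < c + 1) :
    ∀ s, 0 ≤ s → s ≤ (c + 1 - X) / a →
      ∃ k : ℤ, Over p (γ (t + s)) (X + s * a) (Y + s * b + 2 * k * colHeight p c) ∧
        |Y + s * b + 2 * k * colHeight p c| ≤ colHeight p c := by
  apply real_induction
  · exact ⟨0, by simpa using h.over, by simpa using h.abs_snd_le ha h1 h2⟩
  · intro s hs hsT hQ
    rw [lt_div_iff₀ ha] at hsT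
    have hsa := mul_nonneg hs ha.le
    obtain ⟨k, hk, hk'⟩ := hQ s hs le_rfl
    have key : ∃ k : ℤ, Leaves p a b γ (t + s) (X + s * a)
        (Y + s * b + 2 * k * colHeight p c) := by
      rcases hs.eq_or_lt with rfl | hs
      · exact ⟨0, by simpa using h⟩
      · obtain ⟨U, V, hUV⟩ := (hγ (t + s)).1
        obtain ⟨e1, e2, e3, e4⟩ := hk.related hUV.over
        have hsa := mul_pos hs ha
        have c1 : (c : ℝ) < X + s * a := by linarith
        have c2 : X + s * a < c + 1 := by linarith
        have e3 := e3.resolve_right (not_onVerticalSide c1 c2)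
        rcases e4 with e4 | e4
        · exact ⟨k, by rwa [e3, e4]⟩
        · have e4 := e4.eq_colHeight c1 c2
          rcases abs_eq_abs.1 e2 with e2 | e2
          · exact ⟨k, by rwa [e3, e2]⟩
          · have hV : V = -(Y + s * b + 2 * k * colHeight p c) := by linarith
            rcases abs_choice (Y + s * b + 2 * k * colHeight p c) with e5 | e5
            · refine ⟨k - 1, ?_⟩
              have : V = Y + s * b + 2 * ((k - 1 : ℤ) : ℝ) * colHeight p c := by
                push_cast; linarith
              rwa [e3, ← this]
            · refine ⟨k + 1, ?_⟩
              have : V = Y + s * b + 2 * ((k + 1 : ℤ) : ℝ) * colHeight p c := by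
                push_cast; linarith
              rwa [e3, ← this]
    obtain ⟨k, hk⟩ := key
    obtain ⟨η, hη, hb'⟩ := hk.eventually_column ha (c := c) (by linarith) (by linarith)
    have hb0 := hk.abs_snd_le ha (c := c) (by linarith) (by linarith)
    obtain ⟨ε, hε, hk⟩ := hk
    refine ⟨min ε η, lt_min hε hη, fun r h0 hr => ⟨k, ?_, ?_⟩⟩
    · convert hk r h0 (hr.trans (min_le_left _ _)) using 1 <;> ring_nf
    · rcases h0.eq_or_lt with rfl | h0
      · simpa using hb0
      · convert hb' r h0 (hr.trans (min_le_right _ _)) using 2; ring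
  · intro s hs hsT hQ
    rw [le_div_iff₀ ha] at hsT
    obtain ⟨U, V, hUV⟩ := (hγ (t + s)).2
    have hsa := mul_pos hs ha
    -- The integer `k` may vary with `r`, so the relation `R` only fixes `V` modulo twice the
    -- height.
    obtain ⟨rfl, k, rfl⟩ : U = X + s * a ∧ ∃ k : ℤ, V = Y + s * b + 2 * k * colHeight p c := by
      refine hUV.eq_of_frequently ha hb (R := fun U V => U = X + s * a ∧
        ∃ k : ℤ, V = Y + s * b + 2 * k * colHeight p c) hs fun r h0 hr => ?_
      obtain ⟨k, hk, -⟩ := hQ (s - r) (by linarith) (by linarith)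
      refine ⟨_, _, ⟨rfl, k, rfl⟩, ?_⟩
      convert hk using 1 <;> ring_nf
    refine ⟨k, hUV.over, ?_⟩
    obtain ⟨ε, hε, hUV⟩ := hUV
    refine abs_le_of_forall_small (b := -b) (lt_min hε (half_pos hs)) fun r h0 hr => ?_
    have := (hUV r h0.le (hr.trans (min_le_left _ _))).mem
    have hr' : r < s := (hr.trans (min_le_right _ _)).trans_lt (half_lt_self hs)
    have hra := mul_pos h0 ha
    have hrs := mul_lt_mul_of_pos_right hr' ha
    rw [mul_neg, ← sub_eq_add_neg]
    exact abs_le_colHeight (by linarith) (by linarith) this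

end orbits

/-! ### Unique departure and passage between columns -/

section transitions

variable {p : ℕ → ℝ} {a b : ℝ} {γ γ' : ℝ → StepSurface p} {t t' X Y X' Y' : ℝ} {c : ℤ}

/-- At a nonsingular point the outgoing segment is unique. -/
theorem Leaves.unique (hp : Antitone p) (ha : 0 < a) (hb : 0 < b)
    (h : Leaves p a b γ t X Y) (h' : Leaves p a b γ' t' X' Y') (hq : γ t = γ' t')
    (hns : γ t ∉ singularVertices p) : X = X' ∧ Y = Y' := by
  rw [mem_singularVertices_iff h.over] at hns
  obtain ⟨e1, e2, e3, e4⟩ := (h.over.eq_iff h'.over).1 hq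
  have hX : X = X' := by
    by_contra hne
    obtain ⟨n, hn, hXn, hY, -⟩ := e3.resolve_left hne
    -- One of the two mirror abscissas is `n + 1`; leaving from there into column `n + 1` gives the
    -- bound opposite to that of the side.
    have key : |Y| ≤ p (n + 1) ∧ 0 < p (n + 1) := by
      rcases abs_choice X with h0 | h0
      · have hX : X = (((n + 1 : ℕ) : ℤ) : ℝ) := by push_cast; linarith
        exact ⟨h.abs_snd_le ha hX.ge (by linarith), h.colHeight_pos ha hb hX.ge (by linarith)⟩
      · have hX : X' = (((n + 1 : ℕ) : ℤ) : ℝ) := by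
          have := (abs_eq_abs.1 e1).resolve_left hne
          push_cast; linarith
        exact ⟨e2 ▸ h'.abs_snd_le ha hX.ge (by linarith),
          h'.colHeight_pos ha hb hX.ge (by linarith)⟩
    exact hns ⟨n, key.2, hn, hXn, le_antisymm key.1 hY⟩
  subst hX
  refine ⟨rfl, ?_⟩
  by_contra hne
  have hside := e4.resolve_left hne
  have hYY := (abs_eq_abs.1 e2).resolve_left hne
  have f1 : ((⌊X⌋ : ℤ) : ℝ) ≤ X := Int.floor_le X
  have f2 : X < (⌊X⌋ : ℤ) + 1 := Int.lt_floor_add_one X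
  have hlt : |Y| < colHeight p ⌊X⌋ := by
    rw [abs_lt]
    have := h.snd_lt ha hb f1 f2
    have := h'.snd_lt ha hb f1 f2
    constructor <;> linarith
  -- On a vertical line the side may belong to the column on the left: for `X ≥ 0` it is no lower,
  -- for `X < 0` its ceiling can end there in a vertex.
  rcases f1.eq_or_lt with f1 | f1
  · generalize ⌊X⌋ = c at *
    have hY0 : 0 < |Y| := abs_pos.2 fun h0 => hne (by linarith)
    rcases c with m | m
    · simp only [Int.ofNat_eq_natCast, Int.cast_natCast, colHeight_natCast] at f1 hlt
      obtain ⟨n, ⟨g1, g2⟩, g3⟩ := hside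
      rw [← f1, abs_of_nonneg m.cast_nonneg] at g1
      norm_cast at g1
      have := hp g1
      linarith
    · simp only [colHeight_negSucc] at hlt
      have hX : |X| = m + 1 := by
        rw [← f1, Int.cast_negSucc, abs_neg, Nat.abs_cast]; push_cast; rfl
      rw [hX] at hside
      rcases hside.at_nat_succ with g | g
      · linarith
      · exact hns ⟨m, by linarith, by linarith, hX, g⟩
  · exact absurd (hside.eq_colHeight f1 f2) hlt.ne

/-- The possible crossings of a vertical line `x = c + 1` at height `y`, into the column `c'`
at height `y'`. -/
def Crossing (p : ℕ → ℝ) (c : ℤ) (y : ℝ) (c' : ℤ) (y' : ℝ) : Prop :=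
  0 < colHeight p c' ∧ |y| ≤ colHeight p c ∧ |y| ≤ colHeight p c' ∧
    (∃ k : ℤ, y' = y + 2 * k * colHeight p c') ∧
    (c' = c + 1 ∨ ∃ n : ℕ, c = n ∧ c' = Int.negSucc n ∧ p (n + 1) < p n ∧ p (n + 1) ≤ |y|)

theorem exists_eq_add_of_abs_eq {y y' P : ℝ} (h : |y| = |y'|) (hP : |y| = P) :
    ∃ k : ℤ, y' = y + 2 * k * P := by
  rcases abs_eq_abs.1 h with rfl | h'
  · exact ⟨0, by simp⟩
  · rcases abs_choice y with h0 | h0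
    · exact ⟨-1, by push_cast; linarith⟩
    · exact ⟨1, by push_cast; linarith⟩

/-- Where `|X|` grows, the orbit passes below the corner or is carried by the wall to the mirror
column of equal height. Where `|X|` shrinks, the ceiling does not drop, and a vertical side could be
touched only at a vertex. -/
theorem Leaves.crossing (hp : Antitone p) (hnn : ∀ n, 0 ≤ p n) (ha : 0 < a) (hb : 0 < b)
    (h : Leaves p a b γ t X' Y') (hq : Over p (γ t) (c + 1) Y) (hY : |Y| ≤ colHeight p c)
    (hc : 0 < colHeight p c) (hns : γ t ∉ singularVertices p) :
    ∃ c' : ℤ, X' = c' ∧ Crossing p c Y c' Y' := by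
  rw [mem_singularVertices_iff hq] at hns
  obtain ⟨e1, e2, e3, e4⟩ := hq.related h.over
  rcases c with n | n
  · simp only [Int.ofNat_eq_natCast, Int.cast_natCast, colHeight_natCast] at *
    have hn0 : (0 : ℝ) ≤ n := n.cast_nonneg
    have habs : |(n : ℝ) + 1| = n + 1 := abs_of_pos (by linarith)
    rw [habs] at e1 e3 e4
    simp only [habs] at hns
    have hpn : p (n + 1) ≤ p n := hp n.le_succ
    by_cases hX : (n : ℝ) + 1 = X'
    · have hX' : X' = ((n + 1 : ℕ) : ℤ) := by push_cast; exact hX.symm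
      have hle := h.abs_snd_le ha hX'.ge (by linarith)
      have hpos := h.colHeight_pos ha hb hX'.ge (by linarith)
      rw [← e2] at hle
      refine ⟨_, hX', hpos, hY, hle, ?_, Or.inl (by push_cast; rfl)⟩
      rw [colHeight_natCast] at hle ⊢
      rcases e4 with e4 | e4
      · exact ⟨0, by simp [e4]⟩
      · refine exists_eq_add_of_abs_eq e2 ?_
        rcases e4.at_nat_succ with g | g <;> linarith
    · obtain ⟨v1, v2, v3⟩ := (e3.resolve_left hX).at_nat_succ
      have hX' : X' = (Int.negSucc n : ℤ) := by
        rw [Int.cast_negSucc]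
        push_cast
        rcases abs_choice X' with g | g
        · exact absurd (by linarith) hX
        · linarith
      refine ⟨_, hX', hc, hY, hY, ?_, Or.inr ⟨n, rfl, rfl, v1, v2⟩⟩
      rw [colHeight_negSucc]
      rcases e4 with e4 | e4
      · exact ⟨0, by simp [e4]⟩
      · rcases e4.at_nat_succ with g | g
        · exact exists_eq_add_of_abs_eq e2 g
        · have h0 : p (n + 1) = 0 := by
            by_contra h0
            exact hns ⟨n, (hnn _).lt_of_ne' h0, v1, rfl, g⟩
          have hY0 : Y = 0 := by rw [← abs_eq_zero, g, h0]
          have hY0' : Y' = 0 := by rw [← abs_eq_zero, ← e2, g, h0]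
          exact ⟨0, by simp [hY0, hY0']⟩
  · simp only [Int.cast_negSucc, colHeight_negSucc] at *
    rcases n with _ | n
    · norm_num at e1 e3 e4
      have hX' : X' = ((0 : ℕ) : ℤ) := by simpa using e1.symm
      refine ⟨_, hX', hc, hY, hY, ?_, Or.inl (by simp)⟩
      rw [colHeight_natCast]
      rcases e4 with e4 | ⟨m, hm, g⟩
      · exact ⟨0, by simp [e4]⟩
      · have hm0 := hm.1
        norm_cast at hm0
        obtain rfl : m = 0 := by omega
        exact exists_eq_add_of_abs_eq e2 g
    · have hx : -(((n + 1 + 1 : ℕ) : ℝ)) + 1 = -(n + 1) := by push_cast; ring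
      have habs : |-((n : ℝ) + 1)| = n + 1 := by
        rw [abs_neg, abs_of_nonneg (by positivity)]
      rw [hx, habs] at e1 e4
      rw [hx, habs] at e3
      simp only [hx, habs] at hns
      have hpn : p (n + 1) ≤ p n := hp n.le_succ
      by_cases hX : -((n : ℝ) + 1) = X'
      · have hX' : X' = (Int.negSucc n : ℤ) := by
          rw [Int.cast_negSucc]; push_cast; exact hX.symm
        refine ⟨_, hX', hc.trans_le hpn, hY, hY.trans hpn, ?_, Or.inl ?_⟩
        · rw [colHeight_negSucc]
          rcases e4 with e4 | e4
          · exact ⟨0, by simp [e4]⟩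
          · refine exists_eq_add_of_abs_eq e2 ?_
            rcases e4.at_nat_succ with g | g
            · exact g
            · by_contra hne
              exact hns ⟨n, hc, hpn.lt_of_ne (by rwa [g] at hne), rfl, g⟩
        · omega
      · obtain ⟨v1, v2, v3⟩ := (e3.resolve_left hX).at_nat_succ
        exact absurd ⟨n, hc, v1, rfl, le_antisymm hY v2⟩ hns

end transitions

/-! ### Stability of crossings away from the vertices -/

section crossings

variable {p : ℕ → ℝ} {c c₁ c₂ : ℤ} {Y₁ Y₂ y₁ y₂ h δ : ℝ}

/-- The height `y` on the line `x = c + 1` is at least `δ` away from the heights of singular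
vertices on that line. -/
def AvoidsVertex (p : ℕ → ℝ) (δ : ℝ) (c : ℤ) (y : ℝ) : Prop :=
  ∀ n : ℕ, |(c : ℝ) + 1| = n + 1 → 0 < p (n + 1) → p (n + 1) < p n →
    δ ≤ p (n + 1) ∧ δ ≤ |(|y| - p (n + 1))|

theorem abs_natCast_add_one (n : ℕ) : |(((n : ℤ) : ℝ)) + 1| = n + 1 := by
  rw [Int.cast_natCast]; exact abs_of_pos (by positivity)

theorem abs_negSucc_succ_add_one (n : ℕ) : |((Int.negSucc (n + 1) : ℤ) : ℝ) + 1| = n + 1 := by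
  rw [Int.cast_negSucc]; push_cast
  rw [show -((n : ℝ) + 1 + 1) + 1 = -(n + 1) by ring, abs_neg]
  exact abs_of_pos (by positivity)

theorem int_eq_zero_of_abs_lt {k : ℤ} {P : ℝ} (h : |2 * k * P| < 2 * P) : k = 0 := by
  have hP : 0 < P := by have := abs_nonneg (2 * k * P); linarith
  rw [abs_mul, abs_of_pos hP, abs_mul, abs_of_pos (by norm_num : (0 : ℝ) < 2)] at h
  have : |(k : ℝ)| < 1 := by
    by_contra! h1
    nlinarith
  have : |k| < 1 := by exact_mod_cast this
  exact Int.abs_lt_one_iff.1 this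

/-- If the height changes on crossing into the column `c + 1`, then there is a vertex on the
crossing line, and heights that stay `δ` away from it and enter the lower side are confined. -/
theorem exists_confined (hp : Antitone p) (hne : colHeight p (c + 1) ≠ colHeight p c)
    (hpos : 0 < colHeight p c) (hpos' : 0 < colHeight p (c + 1)) :
    ∃ τ, τ ≤ colHeight p c ∧ ∀ y, AvoidsVertex p δ c y → |y| ≤ colHeight p c →
      |y| ≤ colHeight p (c + 1) → |y| ≤ τ - δ := by
  rcases c with n | n
  · simp only [Int.ofNat_eq_natCast] at *
    have hn : ((n : ℤ) + 1) = ((n + 1 : ℕ) : ℤ) := by push_cast; rfl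
    rw [hn, colHeight_natCast, colHeight_natCast] at *
    have hlt := (hp n.le_succ).lt_of_ne hne
    refine ⟨p (n + 1), hlt.le, fun y hy h1 h2 => ?_⟩
    have := (hy n (abs_natCast_add_one n) hpos' hlt).2
    rw [abs_of_nonpos (by linarith)] at this
    linarith
  · rcases n with _ | n
    · exact absurd rfl hne
    · have hn : Int.negSucc (n + 1) + 1 = Int.negSucc n := by omega
      rw [hn, colHeight_negSucc, colHeight_negSucc] at *
      have hlt := (hp n.le_succ).lt_of_ne hne.symm
      refine ⟨p (n + 1), le_rfl, fun y hy h1 h2 => ?_⟩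
      have := (hy n (abs_negSucc_succ_add_one n) hpos hlt).2
      rw [abs_of_nonpos (by linarith)] at this
      linarith

/-- The vertex height would separate `|Y₁|` from `|Y₂|`, each at least `δ` from it, although the
strands are less than `δ` apart; the size bounds exclude a full turn around the circle. -/
theorem not_crossing_split {n : ℕ} (hδ : |h| < δ)
    (hY : ∃ k : ℤ, Y₂ = Y₁ + h + 2 * k * p n) (hlt : p (n + 1) < p n)
    (hpos : 0 < p (n + 1)) (h1 : |Y₁| ≤ p (n + 1)) (h2 : p (n + 1) ≤ |Y₂|) (h2' : |Y₂| ≤ p n)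
    (a1 : AvoidsVertex p δ n Y₁) (a2 : AvoidsVertex p δ n Y₂) : False := by
  obtain ⟨k, hk⟩ := hY
  have a1 := (a1 n (abs_natCast_add_one n) hpos hlt).2
  have a2 := (a2 n (abs_natCast_add_one n) hpos hlt).2
  rw [abs_of_nonpos (by linarith)] at a1
  rw [abs_of_nonneg (by linarith)] at a2
  have hk0 : k = 0 := by
    apply int_eq_zero_of_abs_lt (P := p n)
    rw [show 2 * k * p n = Y₂ - Y₁ - h by linarith]
    have := abs_sub (Y₂ - Y₁) h
    have := abs_sub Y₂ Y₁
    linarith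
  have e : Y₂ = Y₁ + h := by simpa [hk0] using hk
  have := abs_add_le Y₁ h
  rw [← e] at this
  linarith

/-- Two crossings that are less than `δ` apart and avoid the vertices stay parallel. -/
theorem Crossing.parallel (hp : Antitone p) (hc : 0 < colHeight p c) (hδ : |h| < δ)
    (hY : ∃ k : ℤ, Y₂ = Y₁ + h + 2 * k * colHeight p c)
    (x1 : Crossing p c Y₁ c₁ y₁) (x2 : Crossing p c Y₂ c₂ y₂)
    (a1 : AvoidsVertex p δ c Y₁) (a2 : AvoidsVertex p δ c Y₂) :
    c₁ = c₂ ∧ ∃ k : ℤ, y₂ = y₁ + h + 2 * k * colHeight p c₁ := by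
  have parallel_of_eq : ∀ c', colHeight p c' = colHeight p c →
      (∃ k : ℤ, y₁ = Y₁ + 2 * k * colHeight p c') → (∃ k : ℤ, y₂ = Y₂ + 2 * k * colHeight p c') →
      ∃ k : ℤ, y₂ = y₁ + h + 2 * k * colHeight p c' := by
    rintro c' hc' ⟨k1, e1⟩ ⟨k2, e2⟩
    obtain ⟨k, e⟩ := hY
    refine ⟨k2 + k - k1, ?_⟩
    rw [hc'] at *
    push_cast
    linarith
  obtain ⟨q1, r1, s1, m1, d1⟩ := x1
  obtain ⟨q2, r2, s2, m2, d2⟩ := x2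
  rcases d1 with rfl | ⟨n, rfl, rfl, l1, g1⟩ <;> rcases d2 with rfl | ⟨n', hn', rfl, l2, g2⟩
  · refine ⟨rfl, ?_⟩
    by_cases heq : colHeight p (c + 1) = colHeight p c
    · exact parallel_of_eq _ heq m1 m2
    · obtain ⟨τ, hτ, hconf⟩ := exists_confined (δ := δ) hp heq hc q1
      have b1 := hconf _ a1 r1 s1
      have b2 := hconf _ a2 r2 s2
      obtain ⟨k, e⟩ := hY
      -- The next column has another period, so a congruence would not survive. Confinement forces
      -- `k = 0`, making the difference exactly `h`.
      have hk0 : k = 0 := by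
        apply int_eq_zero_of_abs_lt (P := colHeight p c)
        rw [show 2 * k * colHeight p c = Y₂ - Y₁ - h by linarith]
        have := abs_sub (Y₂ - Y₁) h
        have := abs_sub Y₂ Y₁
        have := abs_nonneg h
        linarith
      subst hk0
      obtain ⟨k1, e1⟩ := m1
      obtain ⟨k2, e2⟩ := m2
      refine ⟨k2 - k1, ?_⟩
      push_cast at *
      linarith
  · subst hn'
    have hn : ((n' : ℤ) + 1) = ((n' + 1 : ℕ) : ℤ) := by push_cast; rfl
    rw [hn, colHeight_natCast] at q1 s1
    exact (not_crossing_split hδ hY l2 q1 s1 g2 r2 a1 a2).elim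
  · have hn : ((n : ℤ) + 1) = ((n + 1 : ℕ) : ℤ) := by push_cast; rfl
    rw [hn, colHeight_natCast] at q2 s2
    refine (not_crossing_split (h := -h) (by rwa [abs_neg]) ?_ l1 q2 s2 g1 r1 a2 a1).elim
    obtain ⟨k, e⟩ := hY
    refine ⟨-k, ?_⟩
    rw [colHeight_natCast] at e
    push_cast
    linarith
  · obtain rfl : n = n' := by exact_mod_cast hn'
    exact ⟨rfl, parallel_of_eq _ rfl m1 m2⟩

/-- Multiples of a small number come close to every point of a circle. -/
theorem exists_nat_mul_close {P : ℝ} (hP : 0 < P) (hh : h ≠ 0) (hδ : |h| < δ) (y τ : ℝ) :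
    ∃ (q : ℕ) (k : ℤ) (e : ℝ), |e| < δ ∧ y + q * h = τ + e + 2 * k * P := by
  have key : ∀ h : ℝ, 0 < h → h < δ → ∀ y τ : ℝ, ∃ (q : ℕ) (k : ℤ) (e : ℝ),
      |e| < δ ∧ y + q * h = τ + e + 2 * k * P := by
    intro h hh hδ y τ
    obtain ⟨k, hk⟩ := exists_nat_gt ((y - τ) / (2 * P))
    rw [div_lt_iff₀ (by positivity)] at hk
    set v := (τ + 2 * k * P - y) / h with hv
    have hv0 : 0 ≤ v := div_nonneg (by linarith) hh.le
    have hvh : v * h = τ + 2 * k * P - y := div_mul_cancel₀ _ hh.ne'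
    refine ⟨⌊v⌋₊, k, (⌊v⌋₊ - v) * h, ?_, by push_cast; linarith⟩
    have h1 := Nat.floor_le hv0
    have h2 := Nat.lt_floor_add_one v
    rw [abs_mul, abs_of_pos hh, abs_of_nonpos (by linarith)]
    nlinarith
  rcases lt_or_gt_of_ne hh with h0 | h0
  · rw [abs_of_neg h0] at hδ
    obtain ⟨q, k, e, he, h1⟩ := key (-h) (by linarith) hδ (-y) (-τ)
    exact ⟨q, -k, -e, by rwa [abs_neg], by push_cast; linarith⟩
  · rw [abs_of_pos h0] at hδ
    exact key h h0 hδ y τ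

/-- If `τ + e` exceeds `P`, it reappears near the bottom (`k = -1`), and the absolute value folds it
back near `τ`; `δ ≤ τ` keeps `τ + e` positive. -/
theorem abs_abs_sub_lt_of_close {P τ e Y : ℝ} {k : ℤ} (hτ : τ ≤ P) (hδ : δ ≤ τ) (he : |e| < δ)
    (hY : |Y| ≤ P) (h : Y = τ + e + 2 * k * P) : |(|Y| - τ)| < δ := by
  obtain ⟨e1, e2⟩ := abs_lt.1 he
  obtain ⟨y1, y2⟩ := abs_le.1 hY
  have hP : 0 < P := by linarith
  have hk1 : k < 1 := by
    by_contra! hk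
    have : (1 : ℝ) ≤ k := by exact_mod_cast hk
    nlinarith
  have hk2 : -2 < k := by
    by_contra! hk
    have : (k : ℝ) ≤ -2 := by exact_mod_cast hk
    nlinarith
  obtain rfl | rfl : k = 0 ∨ k = -1 := by omega
  · have : Y = τ + e := by simpa using h
    rw [abs_of_pos (a := Y) (by linarith), this]
    simpa using he
  · have : Y = τ + e - 2 * P := by rw [h]; push_cast; ring
    rw [abs_of_neg (a := Y) (by linarith), abs_lt]
    constructor <;> linarith

end crossings

/-! ### Returns to the same column -/

/-- A sequence of crossings that stays in a bounded region and away from the vertices cannot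
return to the same column at a small nonzero distance. -/
theorem eq_zero_of_return {p : ℕ → ℝ} (hp : Antitone p) (hnn : ∀ n, 0 ≤ p n)
    (hV : ∃ n, 0 < p (n + 1) ∧ p (n + 1) < p n) {c : ℕ → ℤ} {y Y : ℕ → ℝ} {m δ : ℝ} {N : ℤ}
    (hpos : ∀ i, 0 < colHeight p (c i)) (hN : ∀ i, c i ≤ N)
    (hY : ∀ i, ∃ k : ℤ, Y i = y i + m + 2 * k * colHeight p (c i))
    (hx : ∀ i, Crossing p (c i) (Y i) (c (i + 1)) (y (i + 1)))
    (hav : ∀ i, AvoidsVertex p δ (c i) (Y i)) {i D : ℕ} (hcD : c (i + D) = c i)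
    (hδ : |y (i + D) - y i| < δ) : y (i + D) = y i := by
  by_contra hne
  set h := y (i + D) - y i with hh
  have hh0 : h ≠ 0 := sub_ne_zero.2 hne
  -- the orbit stays parallel to its return
  have hY' : ∀ j j', c j = c j' → (∃ k : ℤ, y j' = y j + h + 2 * k * colHeight p (c j)) →
      ∃ k : ℤ, Y j' = Y j + h + 2 * k * colHeight p (c j) := by
    rintro j j' hc ⟨k, e⟩
    obtain ⟨k1, e1⟩ := hY j
    obtain ⟨k2, e2⟩ := hY j'
    rw [← hc] at e2
    exact ⟨k2 + k - k1, by push_cast; linarith⟩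
  have par : ∀ s, c (i + s) = c (i + s + D) ∧
      ∃ k : ℤ, y (i + s + D) = y (i + s) + h + 2 * k * colHeight p (c (i + s)) := by
    intro s
    induction s with
    | zero => exact ⟨hcD.symm, 0, by simp [hh]⟩
    | succ s ih =>
      have x2 := hx (i + s + D)
      have a2 := hav (i + s + D)
      rw [← ih.1] at x2 a2
      have := (hx (i + s)).parallel hp (hpos _) hδ (hY' _ _ ih.1 ih.2) x2 (hav _) a2
      rwa [show i + s + D + 1 = i + (s + 1) + D by ring] at this
  have iter : ∀ s (q : ℕ), c (i + s + q * D) = c (i + s) ∧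
      ∃ k : ℤ, Y (i + s + q * D) = Y (i + s) + q * h + 2 * k * colHeight p (c (i + s)) := by
    intro s q
    induction q with
    | zero => exact ⟨by simp, 0, by simp⟩
    | succ q ih =>
      obtain ⟨ih1, k, ih2⟩ := ih
      have h1 := par (s + q * D)
      rw [← add_assoc] at h1
      obtain ⟨k', h2⟩ := hY' _ _ h1.1 h1.2
      rw [show i + s + q * D + D = i + s + (q + 1) * D by ring] at h1 h2
      refine ⟨h1.1.symm.trans ih1, k + k', ?_⟩
      rw [h2, ih2, ih1]
      push_cast
      ring
  -- hence no visited column ends in a vertex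
  have novertex : ∀ s (n : ℕ), |(c (i + s) : ℝ) + 1| = n + 1 → p (n + 1) ≤ colHeight p (c (i + s)) →
      0 < p (n + 1) → ¬ p (n + 1) < p n := by
    intro s n h1 h2 h3 h4
    obtain ⟨q, k, e, he, hq⟩ := exists_nat_mul_close (hpos (i + s)) hh0 hδ (Y (i + s)) (p (n + 1))
    obtain ⟨hc, k', hk'⟩ := iter s q
    have ha := hav (i + s + q * D) n (by rwa [hc]) h3 h4
    have hle := (hx (i + s + q * D)).2.1
    rw [hc] at hle
    refine absurd (abs_abs_sub_lt_of_close (k := k + k') h2 ha.1 he hle ?_) (not_lt.2 ha.2)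
    rw [hk', hq]
    push_cast
    ring
  -- the orbit is reflected at a wall
  obtain ⟨s, n, hs, hs', hlt⟩ : ∃ s, ∃ n : ℕ, c (i + s) = n ∧ c (i + (s + 1)) = Int.negSucc n ∧
      p (n + 1) < p n := by
    by_contra! hcon
    have : ∀ s : ℕ, c (i + s) = c i + s := by
      intro s
      induction s with
      | zero => simp
      | succ s ih =>
        rcases (hx (i + s)).2.2.2.2 with h1 | ⟨n, h1, h2, h3, -⟩
        · rw [← add_assoc, h1, ih]; push_cast; ring
        · exact absurd h3 (not_lt.2 (hcon s n h1 h2))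
    have h1 := this (N - c i + 1).toNat
    have h2 := hN (i + (N - c i + 1).toNat)
    have h3 := hN i
    omega
  have hwall : p (n + 1) = 0 := by
    by_contra h0
    exact novertex s n (by rw [hs]; exact abs_natCast_add_one n)
      (by rw [hs]; exact hlt.le) ((hnn _).lt_of_ne' h0) hlt
  -- after the reflection it passes all columns
  have back : ∀ q ≤ n, c (i + (s + 1 + q)) = Int.negSucc (n - q) := by
    intro q
    induction q with
    | zero => intro _; simpa using hs'
    | succ q ih =>
      intro hq
      have ih := ih (by omega)
      rcases (hx (i + (s + 1 + q))).2.2.2.2 with h1 | ⟨l, h1, -⟩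
      · rw [show i + (s + 1 + (q + 1)) = i + (s + 1 + q) + 1 by ring, h1, ih]
        omega
      · rw [ih] at h1; omega
  obtain ⟨l, hl, hl'⟩ := hV
  have hln : l + 1 ≤ n := by
    by_contra! h1
    have := hp h1
    linarith
  -- Column `Int.negSucc (l + 1)` has right edge `X = -(l + 1)`, where the vertex lies at the height
  -- of the column.
  have hb := back (n - (l + 1)) (by omega)
  rw [show n - (n - (l + 1)) = l + 1 by omega] at hb
  refine novertex (s + 1 + (n - (l + 1))) l ?_ ?_ hl hl'
  · rw [hb]; exact abs_negSucc_succ_add_one l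
  · rw [hb]; exact le_rfl

/-! ### Time reversal and determinism -/

section reversal

variable {p : ℕ → ℝ} {a b : ℝ} {γ γ' : ℝ → StepSurface p} {t t' X Y : ℝ}

/-- The rotation of the surface by the angle `π`. -/
def rotateSurface (p : ℕ → ℝ) : StepSurface p → StepSurface p :=
  Quotient.map (fun z => ⟨(-z.1.1, -z.1.2), by simpa [unfoldedTable] using z.2⟩) <| by
    rintro z w ⟨h1, h2, h3, h4⟩
    refine ⟨by simpa using h1, by simpa using h2, ?_, ?_⟩
    · simpa using h3
    · simpa using h4

theorem Over.rotate {q : StepSurface p} (h : Over p q X Y) :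
    Over p (rotateSurface p q) (-X) (-Y) := by
  obtain ⟨hz, rfl⟩ := h
  exact ⟨by simpa [unfoldedTable] using hz, rfl⟩

theorem rotateSurface_rotateSurface (q : StepSurface p) :
    rotateSurface p (rotateSurface p q) = q := by
  obtain ⟨X, Y, h⟩ := exists_over p q
  have := h.rotate.rotate
  rw [neg_neg, neg_neg] at this
  exact this.unique h

theorem rotateSurface_injective : Function.Injective (rotateSurface p) :=
  Function.LeftInverse.injective rotateSurface_rotateSurface

theorem rotateSurface_mem_singularVertices {q : StepSurface p} :
    rotateSurface p q ∈ singularVertices p ↔ q ∈ singularVertices p := by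
  obtain ⟨X, Y, h⟩ := exists_over p q
  rw [mem_singularVertices_iff h, mem_singularVertices_iff h.rotate, abs_neg, abs_neg]

/-- Time reversal negates the velocity and the rotation restores it; arriving and leaving segments
change roles. -/
theorem IsLinearOrbit.reverse (h : IsLinearOrbit p a b γ) :
    IsLinearOrbit p a b fun t => rotateSurface p (γ (-t)) := by
  intro t
  obtain ⟨⟨X, Y, ε, hε, h1⟩, X', Y', δ, hδ, h2⟩ := h (-t)
  refine ⟨⟨-X', -Y', δ, hδ, fun s h0 hs => ?_⟩, -X, -Y, ε, hε, fun s h0 hs => ?_⟩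
  · convert (h2 s h0 hs).rotate using 1 <;> ring_nf
  · convert (h1 s h0 hs).rotate using 1 <;> ring_nf

/-- Departures are unique at nonsingular points and arrivals are determined by the past. `hns` may
use agreement up to `s`, because in the backward half of `isPeriodicOrbit_of_eq` nonsingularity is
deduced from that agreement. -/
theorem eq_forward (hp : Antitone p) (ha : 0 < a) (hb : 0 < b) (hγ : IsLinearOrbit p a b γ)
    (hγ' : IsLinearOrbit p a b γ') (h0 : γ t = γ' t')
    (hns : ∀ s, 0 ≤ s → (∀ r, 0 ≤ r → r ≤ s → γ (t + r) = γ' (t' + r)) →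
      γ (t + s) ∉ singularVertices p) {s : ℝ} (hs : 0 ≤ s) : γ (t + s) = γ' (t' + s) := by
  refine real_induction (Q := fun s => γ (t + s) = γ' (t' + s)) (T := s) (by simpa using h0)
    ?_ ?_ s hs le_rfl
  · intro s hs _ hQ
    obtain ⟨X, Y, h⟩ := (hγ (t + s)).1
    obtain ⟨X', Y', h'⟩ := (hγ' (t' + s)).1
    obtain ⟨rfl, rfl⟩ := h.unique hp ha hb h' (hQ s hs le_rfl) (hns s hs hQ)
    obtain ⟨ε, hε, h⟩ := h
    obtain ⟨ε', hε', h'⟩ := h'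
    refine ⟨min ε ε', lt_min hε hε', fun r h0 hr => ?_⟩
    rw [← add_assoc, ← add_assoc]
    exact (h r h0 (hr.trans (min_le_left _ _))).unique (h' r h0 (hr.trans (min_le_right _ _)))
  · intro s hs _ hQ
    obtain ⟨X, Y, h⟩ := (hγ (t + s)).2
    obtain ⟨X', Y', h'⟩ := (hγ' (t' + s)).2
    have ho := h'.over
    obtain ⟨ε', hε', h'⟩ := h'
    have key : X = X' ∧ Y = Y' := by
      refine h.eq_of_frequently ha hb (R := fun U V => U = X' ∧ V = Y') (lt_min hε' hs)
        fun r h0 hr => ⟨X', Y', ⟨rfl, rfl⟩, ?_⟩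
      have := hQ (s - r) (by linarith [hr.trans_le (min_le_right _ _)]) (by linarith)
      rw [← add_sub_assoc, ← add_sub_assoc] at this
      rw [this]
      exact h' r h0.le (hr.le.trans (min_le_left _ _))
    obtain ⟨rfl, rfl⟩ := key
    exact h.over.unique ho

/-- An orbit that avoids the vertices in the future is periodic as soon as it returns to one of
its points. -/
theorem isPeriodicOrbit_of_eq (hp : Antitone p) (ha : 0 < a) (hb : 0 < b)
    (hγ : IsLinearOrbit p a b γ) (hns : ∀ t, 0 ≤ t → γ t ∉ singularVertices p)
    {T : ℝ} (hT : 0 < T) (ht : 0 ≤ t) (h : γ (t + T) = γ t) : IsPeriodicOrbit p γ := by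
  have fwd : ∀ s, 0 ≤ s → γ (t + s + T) = γ (t + s) := fun s hs => by
    rw [eq_forward hp ha hb hγ hγ h.symm (fun r hr _ => hns _ (by linarith)) hs]
    ring_nf
  have bwd : ∀ s, 0 ≤ s → γ (t - s + T) = γ (t - s) := by
    intro s hs
    have key := eq_forward (t := -t) (t' := -(t + T)) (s := s) hp ha hb hγ.reverse hγ.reverse
      (by simp [h]) ?_ hs
    · have := rotateSurface_injective key
      rw [show -(-t + s) = t - s by ring, show -(-(t + T) + s) = t - s + T by ring] at this
      exact this.symm
    · intro s hs hQ
      rw [rotateSurface_mem_singularVertices, show -(-t + s) = t - s by ring]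
      have hper : ∀ r, t - s ≤ r → γ (r + T) = γ r := by
        intro r hr
        rcases le_total t r with h1 | h1
        · have := fwd (r - t) (by linarith)
          rwa [add_sub_cancel] at this
        · have := rotateSurface_injective (hQ (t - r) (by linarith) (by linarith))
          rw [show -(-t + (t - r)) = r by ring,
            show -(-(t + T) + (t - r)) = r + T by ring] at this
          exact this.symm
      -- Multiples of `T` carry the past point to a nonnegative time, where vertices are excluded.
      have hmul : ∀ k : ℕ, γ (t - s + k * T) = γ (t - s) := by
        intro k
        induction k with
        | zero => simp
        | succ k ih =>
          rw [← ih, ← hper (t - s + k * T) (by nlinarith [k.cast_nonneg (α := ℝ)])]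
          push_cast
          ring_nf
      obtain ⟨k, hk⟩ := exists_nat_gt (s / T)
      rw [div_lt_iff₀ hT] at hk
      rw [← hmul k]
      exact hns _ (by linarith)
  refine ⟨T, hT, fun r => ?_⟩
  rcases le_total t r with h1 | h1
  · have := fwd (r - t) (by linarith)
    rwa [add_sub_cancel] at this
  · have := bwd (t - r) (by linarith)
    rwa [sub_sub_cancel] at this

end reversal

/-! ### Bounded orbits avoiding the vertices -/

theorem exists_pos_le_of_forall_lt {d : ℕ → ℝ} (hd : ∀ n, 0 < d n) (N : ℕ) :
    ∃ δ > 0, ∀ n < N, δ ≤ d n := by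
  induction N with
  | zero => exact ⟨1, one_pos, by simp⟩
  | succ N ih =>
    obtain ⟨δ, hδ, h⟩ := ih
    refine ⟨min δ (d N), lt_min hδ (hd N), fun n hn => ?_⟩
    rcases Nat.lt_succ_iff_lt_or_eq.1 hn with h1 | rfl
    · exact (min_le_left _ _).trans (h n h1)
    · exact min_le_right _ _

/-- Pigeonhole over columns and height cells of width `δ`. -/
theorem exists_lt_close {c : ℕ → ℤ} {y : ℕ → ℝ} {N : ℤ} {M δ : ℝ} (hδ : 0 < δ)
    (hc : ∀ i, |c i| ≤ N) (hy : ∀ i, |y i| ≤ M) :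
    ∃ i j, i < j ∧ c j = c i ∧ |y j - y i| < δ := by
  obtain ⟨i, -, j, -, hij, h⟩ := Set.infinite_univ.exists_ne_map_eq_of_mapsTo
    (f := fun i => (c i, ⌊y i / δ⌋)) (t := Icc (-N) N ×ˢ Icc ⌊-M / δ⌋ ⌊M / δ⌋)
    (fun i _ => ⟨abs_le.1 (hc i), Int.floor_le_floor (by gcongr; exact (abs_le.1 (hy i)).1),
      Int.floor_le_floor (by gcongr; exact (abs_le.1 (hy i)).2)⟩)
    ((Set.finite_Icc _ _).prod (Set.finite_Icc _ _))
  simp only [Prod.mk.injEq] at h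
  have close := Int.abs_sub_lt_one_of_floor_eq_floor h.2
  rw [← sub_div, abs_div, abs_of_pos hδ, div_lt_one hδ] at close
  rcases lt_or_gt_of_ne hij with h1 | h1
  · exact ⟨i, j, h1, h.1.symm, by rwa [abs_sub_comm]⟩
  · exact ⟨j, i, h1, h.1, close⟩

theorem colHeight_le {p : ℕ → ℝ} (hp : Antitone p) (c : ℤ) : colHeight p c ≤ p 0 := by
  rcases c with n | n <;> exact hp n.zero_le

/-- The points over the table lie in a bounded part of it. -/
def IsBoundedSet (p : ℕ → ℝ) (A : Set (StepSurface p)) : Prop :=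
  ∃ N : ℕ, ∀ q ∈ A, ∀ X Y, Over p q X Y → |X| ≤ N

/-- The set `A` stays away from the singular vertices, measured on the vertical lines through
them. -/
def AvoidsVertices (p : ℕ → ℝ) (A : Set (StepSurface p)) : Prop :=
  ∀ n : ℕ, 0 < p (n + 1) → p (n + 1) < p n → ∃ δ > 0, ∀ q ∈ A, ∀ X Y, Over p q X Y →
    |X| = n + 1 → δ ≤ |(|Y| - p (n + 1))|

theorem AvoidsVertices.notMem {p : ℕ → ℝ} {A : Set (StepSurface p)} (h : AvoidsVertices p A)
    {q : StepSurface p} (hq : q ∈ A) : q ∉ singularVertices p := by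
  obtain ⟨X, Y, ho⟩ := exists_over p q
  rw [mem_singularVertices_iff ho]
  rintro ⟨n, h1, h2, h3, h4⟩
  obtain ⟨δ, hδ, h⟩ := h n h1 h2
  have := h q hq X Y ho h3
  rw [h4, sub_self, abs_zero] at this
  linarith

/-- Sampling on successive vertical lines turns the flow into the sequence of crossings treated by
`eq_zero_of_return`. -/
theorem isPeriodicOrbit_of_bounded {p : ℕ → ℝ} (hp : Antitone p) (hnn : ∀ n, 0 ≤ p n)
    (hV : ∃ n, 0 < p (n + 1) ∧ p (n + 1) < p n) {a b : ℝ} (ha : 0 < a) (hb : 0 < b)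
    {γ : ℝ → StepSurface p} (hγ : IsLinearOrbit p a b γ) (hbd : IsBoundedSet p (γ '' Ici 0))
    (hav : AvoidsVertices p (γ '' Ici 0)) : IsPeriodicOrbit p γ := by
  have hns : ∀ t, 0 ≤ t → γ t ∉ singularVertices p := fun t ht =>
    hav.notMem (mem_image_of_mem γ ht)
  obtain ⟨N, hN⟩ := hbd
  have hN : ∀ t, 0 ≤ t → ∀ X Y, Over p (γ t) X Y → |X| ≤ N := fun t ht =>
    hN _ (mem_image_of_mem γ ht)
  have hd : ∀ n : ℕ, ∃ d > 0, 0 < p (n + 1) → p (n + 1) < p n → d ≤ p (n + 1) ∧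
      ∀ t, 0 ≤ t → ∀ X Y, Over p (γ t) X Y → |X| = n + 1 → d ≤ |(|Y| - p (n + 1))| := by
    intro n
    by_cases h : 0 < p (n + 1) ∧ p (n + 1) < p n
    · obtain ⟨δ, hδ, h'⟩ := hav n h.1 h.2
      -- The cap `p (n + 1)` supplies the first bound in `AvoidsVertex`.
      exact ⟨min δ (p (n + 1)), lt_min hδ h.1, fun _ _ => ⟨min_le_right _ _,
        fun t ht X Y ho hX => (min_le_left _ _).trans (h' _ (mem_image_of_mem γ ht) X Y ho hX)⟩⟩
    · exact ⟨1, one_pos, fun h1 h2 => absurd ⟨h1, h2⟩ h⟩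
  choose d hd0 hd using hd
  -- Only vertices with `n + 1 ≤ N` are in reach, so one `δ` serves all.
  obtain ⟨δ, hδ, hδd⟩ := exists_pos_le_of_forall_lt hd0 N
  have avoid : ∀ (t : ℝ) (c : ℤ) (Y : ℝ), 0 ≤ t → Over p (γ t) (c + 1) Y →
      AvoidsVertex p δ c Y := by
    intro t c Y ht ho n hn h1 h2
    have hle := hN t ht _ _ ho
    rw [hn] at hle
    norm_cast at hle
    obtain ⟨g1, g2⟩ := hd n h1 h2
    exact ⟨(hδd n hle).trans g1, (hδd n hle).trans (g2 t ht _ _ ho hn)⟩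
  -- from one vertical line to the next
  have next : ∀ (t X Y : ℝ) (c : ℤ), 0 ≤ t → Leaves p a b γ t X Y → (c : ℝ) ≤ X → X < c + 1 →
      ∃ V, (∃ k : ℤ, V = Y + (c + 1 - X) / a * b + 2 * k * colHeight p c) ∧
        AvoidsVertex p δ c V ∧
        ∀ X' Y', Leaves p a b γ (t + (c + 1 - X) / a) X' Y' →
          ∃ c' : ℤ, X' = c' ∧ Crossing p c V c' Y' := by
    intro t X Y c ht hL h1 h2
    have hpos : 0 ≤ (c + 1 - X) / a := div_nonneg (by linarith) ha.le
    obtain ⟨k, ho, hle⟩ := hL.traverse hγ ha hb h1 h2 _ hpos le_rfl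
    rw [div_mul_cancel₀ _ ha.ne', add_sub_cancel] at ho
    exact ⟨_, ⟨k, rfl⟩, avoid _ _ _ (by linarith) ho, fun X' Y' h' =>
      h'.crossing hp hnn ha hb ho hle (hL.colHeight_pos ha hb h1 h2) (hns _ (by linarith))⟩
  obtain ⟨X₀, Y₀, h₀⟩ := (hγ 0).1
  set t₀ : ℝ := (⌊X₀⌋ + 1 - X₀) / a with ht₀
  have ht₀0 : 0 ≤ t₀ := div_nonneg (by linarith [Int.lt_floor_add_one X₀]) ha.le
  have hti : ∀ i : ℕ, 0 ≤ t₀ + i / a := fun i => by positivity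
  have hstep : ∀ (i : ℕ) (c : ℤ), t₀ + (i : ℝ) / a + (c + 1 - c) / a = t₀ + (i + 1 : ℕ) / a := by
    intro i c; push_cast; ring
  have states : ∀ i : ℕ, ∃ (c : ℤ) (y : ℝ), Leaves p a b γ (t₀ + i / a) c y := by
    intro i
    obtain ⟨X, Y, h⟩ := (hγ (t₀ + i / a)).1
    induction i generalizing X Y with
    | zero =>
      obtain ⟨V, -, -, hn⟩ := next 0 X₀ Y₀ ⌊X₀⌋ le_rfl h₀ (Int.floor_le _)
        (Int.lt_floor_add_one _)
      obtain ⟨c, rfl, -⟩ := hn X Y (by simpa using h)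
      exact ⟨c, Y, h⟩
    | succ i ih =>
      obtain ⟨X', Y', h'⟩ := (hγ (t₀ + i / a)).1
      obtain ⟨c, y, hL⟩ := ih X' Y' h'
      obtain ⟨V, -, -, hn⟩ := next _ _ _ c (hti i) hL le_rfl (by linarith)
      rw [hstep] at hn
      obtain ⟨c', rfl, -⟩ := hn X Y h
      exact ⟨c', Y, h⟩
  choose c y hL using states
  have hnext : ∀ i : ℕ, ∃ V, (∃ k : ℤ, V = y i + b / a + 2 * k * colHeight p (c i)) ∧
      AvoidsVertex p δ (c i) V ∧ Crossing p (c i) V (c (i + 1)) (y (i + 1)) := by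
    intro i
    obtain ⟨V, ⟨k, e⟩, hV, hn⟩ := next _ _ _ (c i) (hti i) (hL i) le_rfl (by linarith)
    rw [hstep] at hn
    obtain ⟨c', hc', hx⟩ := hn _ _ (hL (i + 1))
    obtain rfl : c (i + 1) = c' := by exact_mod_cast hc'
    exact ⟨V, ⟨k, by rw [e]; ring⟩, hV, hx⟩
  choose V hVk hVa hVx using hnext
  have hcN : ∀ i, |c i| ≤ (N : ℤ) := fun i => by
    have := hN _ (hti i) _ _ (hL i).over
    exact_mod_cast this
  obtain ⟨i, j, hij, hcij, hyij⟩ := exists_lt_close (c := c) (y := y) hδ hcN (M := p 0) fun i =>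
    ((hL i).abs_snd_le ha le_rfl (by linarith)).trans (colHeight_le hp _)
  obtain ⟨D, rfl⟩ := Nat.exists_eq_add_of_lt hij
  rw [add_assoc] at hcij hyij
  have hy := eq_zero_of_return hp hnn hV
    (fun i => (hL i).colHeight_pos ha hb le_rfl (by linarith))
    (fun i => (abs_le.1 (hcN i)).2) hVk hVx hVa hcij hyij
  have hret := hL (i + (D + 1))
  rw [hcij, hy] at hret
  refine isPeriodicOrbit_of_eq hp ha hb hγ hns (T := (D + 1 : ℕ) / a) (by positivity) (hti i) ?_
  rw [show t₀ + (i : ℝ) / a + (D + 1 : ℕ) / a = t₀ + (i + (D + 1) : ℕ) / a by push_cast; ring]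
  exact hret.over.unique (hL i).over

/-! ### From closures in the compactification to bounds -/

section closure

variable {p : ℕ → ℝ}

theorem continuous_surfacePoint :
    Continuous fun z : unfoldedTable p => (Quotient.mk (sideSetoid p) z : StepSurface p) :=
  continuous_quotient_mk'

/-- The distance of a point of the surface from the axis `X = 0`. -/
def absX (p : ℕ → ℝ) : StepSurface p → ℝ :=
  Quotient.lift (fun z : unfoldedTable p => |z.1.1|) fun _ _ h => h.1

theorem continuous_absX : Continuous (absX p) :=
  Continuous.quotient_lift (by fun_prop) _

theorem Over.absX_eq {q : StepSurface p} {X Y : ℝ} (h : Over p q X Y) : absX p q = |X| := by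
  obtain ⟨hz, rfl⟩ := h
  rfl

theorem isBoundedSet_of_isCompact {A K : Set (StepSurface p)} (hK : IsCompact K) (hA : A ⊆ K) :
    IsBoundedSet p A := by
  obtain ⟨M, hM⟩ := (hK.image continuous_absX).bddAbove
  obtain ⟨N, hN⟩ := exists_nat_ge M
  refine ⟨N, fun q hq X Y h => ?_⟩
  rw [← h.absX_eq]
  exact (hM (mem_image_of_mem _ (hA hq))).trans hN

/-- A vertex has four copies in the plane; each has a ball missing the preimage of `F`, whose
section by the vertical line gives the bound. -/
theorem avoidsVertices_of_isClosed {A F : Set (StepSurface p)} (hF : IsClosed F) (hA : A ⊆ F)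
    (hFV : ∀ v ∈ singularVertices p, v ∉ F) : AvoidsVertices p A := by
  intro n hpos hlt
  have near : ∀ X₀ Y₀ : ℝ, |X₀| = n + 1 → |Y₀| = p (n + 1) → ∃ δ > 0, ∀ q ∈ A, ∀ X Y,
      Over p q X Y → X = X₀ → δ ≤ |Y - Y₀| := by
    intro X₀ Y₀ hX hY
    have hz : (X₀, Y₀) ∈ unfoldedTable p :=
      mem_unfoldedTable.2 ⟨n + 1, by rw [hX]; push_cast; rfl, by rw [hX]; push_cast; linarith,
        hY.le⟩
    have hv := hFV (surfacePoint p (X₀, Y₀) hz) ⟨_, hz, rfl, n, hpos, hlt, hX, hY⟩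
    have hopen := (hF.preimage continuous_surfacePoint).isOpen_compl
    obtain ⟨δ, hδ, hball⟩ := Metric.isOpen_iff.1 hopen ⟨(X₀, Y₀), hz⟩ hv
    refine ⟨δ, hδ, ?_⟩
    rintro q hq X Y ⟨hXY, rfl⟩ rfl
    by_contra! hlt
    refine hball (a := ⟨(X, Y), hXY⟩) ?_ (hA hq)
    rw [Metric.mem_ball, Subtype.dist_eq, Prod.dist_eq, dist_self, Real.dist_eq]
    exact max_lt hδ hlt
  have hn : |(n : ℝ) + 1| = n + 1 := abs_of_pos (by positivity)
  obtain ⟨d1, hd1, h1⟩ := near (n + 1) (p (n + 1)) hn (abs_of_pos hpos)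
  obtain ⟨d2, hd2, h2⟩ := near (n + 1) (-p (n + 1)) hn (by rw [abs_neg, abs_of_pos hpos])
  obtain ⟨d3, hd3, h3⟩ := near (-(n + 1)) (p (n + 1)) (by rw [abs_neg, hn]) (abs_of_pos hpos)
  obtain ⟨d4, hd4, h4⟩ := near (-(n + 1)) (-p (n + 1)) (by rw [abs_neg, hn])
    (by rw [abs_neg, abs_of_pos hpos])
  refine ⟨min (min d1 d2) (min d3 d4), by positivity, fun q hq X Y ho hX => ?_⟩
  rcases abs_choice Y with hY | hY <;> rcases abs_choice X with hX' | hX' <;>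
    rw [hX'] at hX <;> rw [hY]
  · exact (min_le_left _ _).trans ((min_le_left _ _).trans (h1 q hq X Y ho hX))
  · exact (min_le_right _ _).trans ((min_le_left _ _).trans (h3 q hq X Y ho (by linarith)))
  · rw [← abs_neg, show -(-Y - p (n + 1)) = Y - -p (n + 1) by ring]
    exact (min_le_left _ _).trans ((min_le_right _ _).trans (h2 q hq X Y ho hX))
  · rw [← abs_neg, show -(-Y - p (n + 1)) = Y - -p (n + 1) by ring]
    exact (min_le_right _ _).trans ((min_le_right _ _).trans (h4 q hq X Y ho (by linarith)))

/-- A set whose closure meets neither the vertices nor infinity is bounded and avoids the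
vertices. -/
theorem isBoundedSet_and_avoidsVertices {A : Set (StepSurface p)}
    (h : ¬ (closureWithInfinity p A ∩ singularVerticesWithInfinity p).Nonempty) :
    IsBoundedSet p A ∧ AvoidsVertices p A := by
  have hcl : IsClosed (closureWithInfinity p A) := isClosed_closure
  have hA : A ⊆ (fun v : StepSurface p => (v : OnePoint (StepSurface p))) ⁻¹'
      closureWithInfinity p A := fun q hq => subset_closure (mem_image_of_mem _ hq)
  have hinf : (∞ : OnePoint (StepSurface p)) ∉ closureWithInfinity p A := fun hm =>
    h ⟨∞, hm, Or.inr rfl⟩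
  -- The complement of the closure is an open neighbourhood of `∞`, so the trace of the closure on
  -- the surface is compact.
  have hK := (OnePoint.isOpen_def.1 hcl.isOpen_compl).1 hinf
  rw [preimage_compl, compl_compl] at hK
  refine ⟨isBoundedSet_of_isCompact hK hA,
    avoidsVertices_of_isClosed (hcl.preimage OnePoint.continuous_coe) hA fun v hv hm => ?_⟩
  exact h ⟨v, hm, Or.inl (mem_image_of_mem _ hv)⟩

end closure

section rotation

variable {p : ℕ → ℝ} {A : Set (StepSurface p)}

theorem IsBoundedSet.rotate (h : IsBoundedSet p A) : IsBoundedSet p (rotateSurface p '' A) := by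
  obtain ⟨N, hN⟩ := h
  refine ⟨N, ?_⟩
  rintro _ ⟨q, hq, rfl⟩ X Y ho
  have := ho.rotate
  rw [rotateSurface_rotateSurface] at this
  simpa using hN q hq _ _ this

theorem AvoidsVertices.rotate (h : AvoidsVertices p A) :
    AvoidsVertices p (rotateSurface p '' A) := by
  intro n h1 h2
  obtain ⟨δ, hδ, h⟩ := h n h1 h2
  refine ⟨δ, hδ, ?_⟩
  rintro _ ⟨q, hq, rfl⟩ X Y ho hX
  have := ho.rotate
  rw [rotateSurface_rotateSurface] at this
  simpa using h q hq _ _ this (by simpa using hX)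

end rotation

theorem IsPeriodicOrbit.of_reverse {p : ℕ → ℝ} {γ : ℝ → StepSurface p}
    (h : IsPeriodicOrbit p fun t => rotateSurface p (γ (-t))) : IsPeriodicOrbit p γ := by
  obtain ⟨T, hT, h⟩ := h
  refine ⟨T, hT, fun t => ?_⟩
  have := rotateSurface_injective (h (-(t + T)))
  rw [show -(-(t + T) + T) = t by ring, neg_neg] at this
  exact this.symm

theorem mainTheorem7 (p : ℕ → ℝ) (hnonneg : ∀ n, 0 ≤ p n) (hanti : Antitone p)
    (hlim : Tendsto p atTop (𝓝 0)) (hV : (singularVertices p).Nonempty)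
    (θ : ℝ) (hθ : θ ∈ Ioo 0 (Real.pi / 2))
    (x : StepSurface p) (γ : ℝ → StepSurface p) (hγ : IsBilliardOrbit p θ γ) (hx : γ 0 = x)
    (hnp : ¬ IsPeriodicOrbit p γ) :
    (closureWithInfinity p (γ '' Ici 0) ∩ singularVerticesWithInfinity p).Nonempty ∧
    (closureWithInfinity p (γ '' Iic 0) ∩ singularVerticesWithInfinity p).Nonempty := by
  have hcos : 0 < Real.cos θ := Real.cos_pos_of_mem_Ioo ⟨by linarith [hθ.1, Real.pi_pos], hθ.2⟩
  have hsin : 0 < Real.sin θ := Real.sin_pos_of_pos_of_lt_pi hθ.1 (by linarith [hθ.2, Real.pi_pos])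
  have hvertex : ∃ n, 0 < p (n + 1) ∧ p (n + 1) < p n := by
    obtain ⟨v, z, hz, -, n, h1, h2, -⟩ := hV
    exact ⟨n, h1, h2⟩
  have hlin := hγ.isLinearOrbit
  constructor
  · by_contra hcon
    obtain ⟨h1, h2⟩ := isBoundedSet_and_avoidsVertices hcon
    exact hnp (isPeriodicOrbit_of_bounded hanti hnonneg hvertex hcos hsin hlin h1 h2)
  · by_contra hcon
    obtain ⟨h1, h2⟩ := isBoundedSet_and_avoidsVertices hcon
    have himage : (fun t => rotateSurface p (γ (-t))) '' Ici 0 =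
        rotateSurface p '' (γ '' Iic 0) := by
      rw [image_image, ← neg_zero (G := ℝ), ← image_neg_Ici, image_image, neg_zero]
    refine hnp (isPeriodicOrbit_of_bounded hanti hnonneg hvertex hcos hsin hlin.reverse
      ?_ ?_).of_reverse
    · rw [himage]; exact h1.rotate
    · rw [himage]; exact h2.rotate
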